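/- **Setting.** Let $N\ge 1$, let $\mathcal D$ be a finite nonempty set of secrets, $\mathcal M$ a set of outer queries and $\mathcal V$ a set of outputs. A permutation challenge game $\mathbf{PC}=\mathbf{PC}(N,\mathcal D,\mathcal M,\mathbf{tr},\mathbf{post},\mathbf{suc})$ consists of a translation function $\mathbf{tr}:\mathcal D\times\mathcal M\to[N]$, a post-processing function $\mathbf{post}:\mathcal D\times[N]\to[N]$, and an arbitrary $0/1$ success predicate $\mathbf{suc}$. Given a permutation $\sigma$ of $[N]$ and a secret $d$, an inner query asks for $\sigma(x)$ or $\sigma^{-1}(y)$ with $x,y\in[N]$, and an outer query $m\in\mathcal M$ is answered by $\mathbf{post}(d,\sigma(\mathbf{tr}(d,m)))$. The predicate receives $d$, the adversary's output in $\mathcal V$, and the query answers the adversary obtained, namely the set of pairs $(x,\sigma(x))$ learned from inner queries (a query $\sigma^{-1}(y)=x$ gives the pair $(x,y)$) and the set of pairs (outer query, answer). For real $u>0$, $\mathbf{tr}$ is $u$-uniform if $|\{d\in\mathcal D:\mathbf{tr}(d,m)=j\}|\le|\mathcal D|/u$ for all $m\in\mathcal M$ and $j\in[N]$. A non-adaptive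 $(S,T)$ algorithm with preprocessing is a pair of deterministic algorithms $(A_0,A_1)$. $A_0$ maps $\sigma$ to an advice string $z\in\{0,1\}^S$. Given $z$, $A_1$ makes at most $T$ inner and outer queries in total, which depend only on $z$, and its output in $\mathcal V$ is a function of $z$ and of the answers. Its success probability is the probability that $\mathbf{suc}$ outputs $1$, over a uniform permutation $\sigma$ of $[N]$ and an independent uniform $d\in\mathcal D$. The predicate does not receive $z$. In the game $\mathbf{MID}$, a deterministic adversary first chooses sequences $I=(I_1,\dots,I_{T_1})$ and $O=(O_1,\dots,O_{T_1})$, each consisting of distinct elements of $[N]$. Then $\sigma$ is drawn uniformly from the permutations of $[N]$ with $\sigma(I_j)=O_j$ for all $j$, and $d\in\mathcal D$ is drawn uniformly and independently. The adversary makes $T_2$ outer queries, fixed in advance (they may depend on $I,O$), and no inner queries, and gives an output in $\mathcal V$ that is a function of the answers. Success is decided by the same predicate, with the set of fixed pairs $(I_j,O_j)$ in place of the pairs learned from inner queries. Its running time is $T_1+T_2$. Let $\widehat{\mathbf{MaxS}}(T)$ be the optimal success probability in $\mathbf{MID}$ of an adversary with running time at most $T$. **Theorem.** Let $\mathbf{tr}$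 be $u$-uniform, and let $(A_0,A_1)$ be a non-adaptive $(S,T)$ algorithm with preprocessing for $\mathbf{PC}$. Then the success probability of $(A_0,A_1)$ is at most $$\min\left(2\,\widehat{\mathbf{MaxS}}(T)+\frac{4\ln(2)\,S\,T}{u},\ \ \widehat{\mathbf{MaxS}}(T)+\sqrt{\frac{\ln(2)\,S\,T}{u}}\right).$$ -/

import Mathlib

open scoped BigOperators

namespace PermChallenge

/-- A permutation challenge game on `[N]` (modelled as `Fin N`) with secret space `D`, outer query
space `M` and output domain `V`.

* `tr` translates an outer query `m` under the secret `d` to an input of the permutation;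
* `post` post-processes the value of the permutation under the secret;
* `suc d v I O` is the 0/1 success predicate. It receives the secret `d`, the output `v` of the
  adversary, and the answers the adversary obtained: the set `I` of all known input-output pairs
  `(x, σ x)` of the permutation, and the set `O` of all pairs (outer query, answer). -/
structure Game (N : ℕ) (D M V : Type*) where
  tr : D → M → Fin N
  post : D → Fin N → Fin N
  suc : D → V → Set (Fin N × Fin N) → Set (M × Fin N) → Bool

/-- A deterministic non-adaptive online algorithm: its inner queries to `σ`, its inner queries to
`σ⁻¹` and its outer queries are fixed; its output is a function of all the answers. -/
structure OnlineAlg (N : ℕ) (M V : Type*) where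
  fwd : Finset (Fin N)
  bwd : Finset (Fin N)
  outer : Finset M
  output : (fwd → Fin N) → (bwd → Fin N) → (outer → Fin N) → V

/-- A deterministic non-adaptive algorithm with `S` bits of preprocessing: `pre` maps the
permutation to the advice string, and `online z` is the online algorithm run with advice `z`. -/
structure PreprocAlg (N : ℕ) (M V : Type*) (S : ℕ) where
  pre : Equiv.Perm (Fin N) → (Fin S → Bool)
  online : (Fin S → Bool) → OnlineAlg N M V

/-- A deterministic non-adaptive adversary in the middle game. It fixes the values
`σ (I j) = O j` for `j < T₁`, where `I` and `O` are sequences without repetitions, and then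
makes only outer queries. (The set `outer` and the function `output` may depend on `I` and `O`,
which are fixed by the same adversary.) -/
structure MidAdversary (N : ℕ) (M V : Type*) where
  T₁ : ℕ
  I : Fin T₁ ↪ Fin N
  O : Fin T₁ ↪ Fin N
  outer : Finset M
  output : (outer → Fin N) → V

namespace OnlineAlg

variable {N : ℕ} {M V : Type*}

/-- The number of oracle queries, inner and outer. -/
def queries (A : OnlineAlg N M V) : ℕ := A.fwd.card + A.bwd.card + A.outer.card

/-- The input-output pairs of `σ` learned from the inner queries; a query `σ⁻¹ y = x` counts as
the pair `(x, y)`. -/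
def innerView (A : OnlineAlg N M V) (σ : Equiv.Perm (Fin N)) : Set (Fin N × Fin N) :=
  {p | σ p.1 = p.2 ∧ (p.1 ∈ A.fwd ∨ p.2 ∈ A.bwd)}

end OnlineAlg

namespace PreprocAlg

variable {N : ℕ} {M V : Type*} {S : ℕ}

/-- The online algorithm makes at most `T` oracle queries. -/
def MakesAtMost (A : PreprocAlg N M V S) (T : ℕ) : Prop := ∀ z, (A.online z).queries ≤ T

end PreprocAlg

namespace MidAdversary

variable {N : ℕ} {M V : Type*}

/-- The total running time: fixed values plus outer queries. -/
def time (B : MidAdversary N M V) : ℕ := B.T₁ + B.outer.card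

/-- The input-output pairs of the permutation fixed by the adversary. -/
def fixedPairs (B : MidAdversary N M V) : Set (Fin N × Fin N) :=
  Set.range fun j => (B.I j, B.O j)

/-- The permutations that satisfy the constraints of the adversary. -/
def perms (B : MidAdversary N M V) : Finset (Equiv.Perm (Fin N)) :=
  Finset.univ.filter fun σ => ∀ j, σ (B.I j) = B.O j

end MidAdversary

namespace Game

variable {N : ℕ} {D M V : Type*}

/-- The translation function is `u`-uniform. -/
def IsUniform [Fintype D] (G : Game N D M V) (u : ℝ) : Prop :=
  ∀ (m : M) (j : Fin N),
    ((Finset.univ.filter fun d => G.tr d m = j).card : ℝ) ≤ (Fintype.card D : ℝ) / u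

/-- The answer of the outer oracle. -/
def answer (G : Game N D M V) (σ : Equiv.Perm (Fin N)) (d : D) (m : M) : Fin N :=
  G.post d (σ (G.tr d m))

/-- The pairs (outer query, answer) for the outer queries in `U`. -/
def outerView (G : Game N D M V) (σ : Equiv.Perm (Fin N)) (d : D) (U : Finset M) :
    Set (M × Fin N) :=
  {p | p.1 ∈ U ∧ p.2 = G.answer σ d p.1}

/-- The output of the online algorithm when its oracles are given by `σ` and `d`. -/
def run (G : Game N D M V) (A : OnlineAlg N M V) (σ : Equiv.Perm (Fin N)) (d : D) : V :=
  A.output (fun x => σ x) (fun y => σ.symm y) (fun m => G.answer σ d m)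

/-- The value of the success predicate on the online algorithm. -/
def sucOnline (G : Game N D M V) (A : OnlineAlg N M V) (σ : Equiv.Perm (Fin N)) (d : D) : Bool :=
  G.suc d (G.run A σ d) (A.innerView σ) (G.outerView σ d A.outer)

/-- The success probability of an algorithm with preprocessing: `σ` is a uniform permutation, the
secret is uniform and independent of it, and the advice is `A.pre σ`. -/
noncomputable def successProb [Fintype D] {S : ℕ} (G : Game N D M V)
    (A : PreprocAlg N M V S) : ℝ :=
  𝔼 σ : Equiv.Perm (Fin N), 𝔼 d : D,
    if G.sucOnline (A.online (A.pre σ)) σ d then (1 : ℝ) else 0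

/-- The value of the success predicate on an adversary in the middle game. The values fixed by the
adversary take the place of the answers to inner queries. -/
def sucMid (G : Game N D M V) (B : MidAdversary N M V) (σ : Equiv.Perm (Fin N)) (d : D) : Bool :=
  G.suc d (B.output fun m => G.answer σ d m) B.fixedPairs (G.outerView σ d B.outer)

/-- The success probability in the middle game: `σ` is uniform among the permutations that satisfy
the constraints, and the secret is uniform and independent of it. -/
noncomputable def midSuccessProb [Fintype D] (G : Game N D M V) (B : MidAdversary N M V) : ℝ :=
  𝔼 σ ∈ B.perms, 𝔼 d : D, if G.sucMid B σ d then (1 : ℝ) else 0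

/-- The optimal success probability in the middle game with running time `T`. -/
noncomputable def midMaxS [Fintype D] (G : Game N D M V) (T : ℕ) : ℝ :=
  sSup {p | ∃ B : MidAdversary N M V, B.time ≤ T ∧ p = G.midSuccessProb B}

end Game

end PermChallenge

namespace PermChallenge
open Finset Equiv

/-! ### A Shearer inequality for the symmetric group -/

/-! Fix the advice `z` and the answers to the inner queries. The permutations compatible with these
answers form a class `C`, and a uniform element of `C` is exactly the permutation of a middle game.
The real permutation is uniform on the smaller set `X ⊆ C` of those that also have advice `z`. Two
facts control the difference.

The entropy deficit `log (|C| / |X|)` is at most `S log 2` on average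
(`expect_log_card_div_card_le`). For a fixed secret `d`, success inside `C` depends only on the
values of `σ` on the set `Q d` of translated outer queries, and uniformity of `tr` puts each point
into at most `c = T |D| / u` of these sets.

A Shearer inequality for the symmetric group (`sum_entropy_condAvg_le`) then says that the marginals
on the sets `Q d` have total entropy deficit at most `2c` times the full deficit, so a random secret
sees only about a fraction `2T / u` of the advice. The Gibbs variational principle
(`sum_mul_le_entropy`) turns this deficit into a bound on success probabilities, with a free
parameter `l` (`expect_mem_le`). The two terms of the minimum come from `l = 1` and from Hoeffding's
lemma with optimal `l`.

Shearer's inequality is proved through random transpositions. Averaging over the values outside `Q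
d` commutes with the generator, and only transpositions that move a point of `Q d` dissipate the
averaged entropy. A transposition moves two points, which gives the factor 2 for the dissipations.
To pass to entropies, minimise the difference of the two sides over densities: at a minimiser the
derivative along the generator is nonnegative, which forces the minimiser to be constant. -/

/-- The symmetrized relative entropy integrand. -/
noncomputable def entropyProduction (x y : ℝ) : ℝ := (x - y) * (Real.log x - Real.log y)

lemma entropyProduction_pos {x y : ℝ} (hx : 0 < x) (hy : 0 < y) (hxy : x ≠ y) :
    0 < entropyProduction x y := by
  rcases lt_or_gt_of_ne hxy with h | h
  · exact mul_pos_of_neg_of_neg (by linarith) (by linarith [Real.log_lt_log hx h])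
  · exact mul_pos (by linarith) (by linarith [Real.log_lt_log hy h])

lemma entropyProduction_self (x : ℝ) : entropyProduction x x = 0 := by
  simp [entropyProduction]

lemma entropyProduction_nonneg {x y : ℝ} (hx : 0 < x) (hy : 0 < y) :
    0 ≤ entropyProduction x y := by
  rcases eq_or_ne x y with rfl | h
  · rw [entropyProduction_self]
  · exact (entropyProduction_pos hx hy h).le

/-- `x log (x / y)` is convex and homogeneous of degree one; this is its tangent plane at `(a, b)`.
-/
lemma mul_log_div_ge {x y a b : ℝ} (hx : 0 < x) (hy : 0 < y) (ha : 0 < a) (hb : 0 < b) :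
    x * (Real.log a - Real.log b) + (x - y * (a / b)) ≤ x * (Real.log x - Real.log y) := by
  have h := Real.one_sub_inv_le_log_of_pos (show 0 < x / y * (b / a) by positivity)
  rw [Real.log_mul (by positivity) (by positivity), Real.log_div hx.ne' hy.ne',
    Real.log_div hb.ne' ha.ne'] at h
  have h2 := mul_le_mul_of_nonneg_left h hx.le
  have h3 : x * (1 - (x / y * (b / a))⁻¹) = x - y * (a / b) := by field_simp
  linarith

lemma entropyProduction_ge {x y a b : ℝ} (hx : 0 < x) (hy : 0 < y) (ha : 0 < a) (hb : 0 < b) :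
    (x - y) * (Real.log a - Real.log b) + (x - y * (a / b)) + (y - x * (b / a))
      ≤ entropyProduction x y := by
  have h1 := mul_log_div_ge hx hy ha hb
  have h2 := mul_log_div_ge hy hx hb ha
  unfold entropyProduction
  linarith

/-- Jensen for a jointly convex function: average the tangent plane taken at the mean point `(a,
b)`, where its correction terms vanish. -/
lemma entropyProduction_expect_le {ι : Type*} {s : Finset ι} (hs : s.Nonempty) {F G : ι → ℝ}
    (hF : ∀ i, 0 < F i) (hG : ∀ i, 0 < G i) :
    entropyProduction (𝔼 i ∈ s, F i) (𝔼 i ∈ s, G i) ≤ 𝔼 i ∈ s, entropyProduction (F i) (G i) := by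
  set a := 𝔼 i ∈ s, F i with ha
  set b := 𝔼 i ∈ s, G i with hb
  have ha0 : 0 < a := expect_pos (fun i _ => hF i) hs
  have hb0 : 0 < b := expect_pos (fun i _ => hG i) hs
  refine le_trans (le_of_eq ?_)
    (expect_le_expect fun i _ => entropyProduction_ge (hF i) (hG i) ha0 hb0)
  rw [expect_add_distrib, expect_add_distrib, ← expect_mul, expect_sub_distrib,
    expect_sub_distrib, expect_sub_distrib, ← expect_mul, ← expect_mul, ← ha, ← hb,
    entropyProduction]
  field_simp
  ring

variable {α : Type*} [Fintype α] [DecidableEq α]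

/-! ### Conditional averages and the random transposition process. -/

/-- The permutations that fix every element of `Q`. -/
def fixing (Q : Finset α) : Finset (Perm α) := univ.filter fun π => ∀ x ∈ Q, π x = x

lemma mem_fixing {Q : Finset α} {π : Perm α} : π ∈ fixing Q ↔ ∀ x ∈ Q, π x = x := by
  simp [fixing]

lemma fixing_nonempty (Q : Finset α) : (fixing Q).Nonempty := ⟨1, by simp [fixing]⟩

lemma mem_of_mem_fixing {Q : Finset α} {π : Perm α} (hπ : π ∈ fixing Q) (x : α) :
    π x ∈ Q ↔ x ∈ Q := by
  rw [mem_fixing] at hπ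
  constructor
  · intro h
    have := π.injective (hπ _ h)
    rwa [this] at h
  · intro h
    rwa [hπ x h]

/-- The conditional expectation of `f` given the values of the permutation on `Q`. -/
noncomputable def condAvg (Q : Finset α) (f : Perm α → ℝ) (σ : Perm α) : ℝ :=
  𝔼 π ∈ fixing Q, f (σ * π)

lemma condAvg_mul_right {Q : Finset α} {f : Perm α → ℝ} {π : Perm α} (hπ : π ∈ fixing Q)
    (σ : Perm α) : condAvg Q f (σ * π) = condAvg Q f σ := by
  rw [mem_fixing] at hπ
  refine expect_equiv (Equiv.mulLeft π) (fun ρ => ?_) (fun ρ _ => ?_)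
  · simp only [mem_fixing, Equiv.coe_mulLeft, Perm.mul_apply]
    refine forall₂_congr fun x hx => ⟨fun h => by rw [h, hπ x hx], fun h => ?_⟩
    exact π.injective (by rw [h, hπ x hx])
  · simp [mul_assoc]

lemma condAvg_pos {Q : Finset α} {f : Perm α → ℝ} (hf : ∀ σ, 0 < f σ) (σ : Perm α) :
    0 < condAvg Q f σ := expect_pos (fun _ _ => hf _) (fixing_nonempty Q)

lemma condAvg_nonneg {Q : Finset α} {f : Perm α → ℝ} (hf : ∀ σ, 0 ≤ f σ) (σ : Perm α) :
    0 ≤ condAvg Q f σ := expect_nonneg fun _ _ => hf _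

lemma sum_condAvg_mul {Q : Finset α} (f X : Perm α → ℝ)
    (hX : ∀ σ, ∀ π ∈ fixing Q, X (σ * π) = X σ) :
    ∑ σ, condAvg Q f σ * X σ = ∑ σ, f σ * X σ := by
  have h : ∀ σ, condAvg Q f σ * X σ = 𝔼 π ∈ fixing Q, f (σ * π) * X (σ * π) := fun σ => by
    rw [condAvg, expect_mul]
    exact expect_congr rfl fun π hπ => by rw [hX σ π hπ]
  simp_rw [h]
  rw [← expect_sum_comm]
  exact (expect_congr rfl fun π _ =>
    _root_.Equiv.sum_comp (Equiv.mulRight π) fun σ => f σ * X σ).trans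
      (expect_const (fixing_nonempty Q) _)

lemma sum_condAvg (Q : Finset α) (f : Perm α → ℝ) : ∑ σ, condAvg Q f σ = ∑ σ, f σ := by
  simpa using sum_condAvg_mul f (fun _ => 1) (Q := Q) (by simp)

/-- The generator of the random transposition process. -/
noncomputable def generator (f : Perm α → ℝ) (σ : Perm α) : ℝ :=
  ∑ a, ∑ b, (f (swap a b * σ) - f σ)

/-- The generator multiplies on the left and the average on the right, so they commute. -/
lemma condAvg_generator (Q : Finset α) (f : Perm α → ℝ) :
    condAvg Q (generator f) = generator (condAvg Q f) := by
  ext σ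
  simp only [condAvg, generator, ← expect_sub_distrib, expect_sum_comm, mul_assoc]

lemma condAvg_add_smul (Q : Finset α) (f g : Perm α → ℝ) (t : ℝ) (σ : Perm α) :
    condAvg Q (fun σ => f σ + t * g σ) σ = condAvg Q f σ + t * condAvg Q g σ := by
  simp only [condAvg, expect_add_distrib, mul_expect]

lemma sum_generator (f : Perm α → ℝ) : ∑ σ, generator f σ = 0 := by
  simp only [generator]
  rw [sum_comm]
  refine sum_eq_zero fun a _ => ?_
  rw [sum_comm]
  refine sum_eq_zero fun b _ => ?_
  rw [sum_sub_distrib, sub_eq_zero]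
  exact _root_.Equiv.sum_comp (Equiv.mulLeft (swap a b)) f

/-- The entropy dissipation of the random transposition process. -/
noncomputable def dissipation (f : Perm α → ℝ) : ℝ :=
  ∑ σ, ∑ a, ∑ b, entropyProduction (f σ) (f (swap a b * σ))

/-- Reversibility: symmetrise each term under the involution `σ ↦ swap a b * σ`. -/
lemma two_mul_sum_log_mul_generator (f : Perm α → ℝ) :
    2 * ∑ σ, Real.log (f σ) * generator f σ = - dissipation f := by
  have key : ∀ a b : α, 2 * ∑ σ, Real.log (f σ) * (f (swap a b * σ) - f σ)
      = - ∑ σ, entropyProduction (f σ) (f (swap a b * σ)) := fun a b => by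
    have h := _root_.Equiv.sum_comp (Equiv.mulLeft (swap a b))
      fun σ => Real.log (f σ) * (f (swap a b * σ) - f σ)
    simp only [Equiv.coe_mulLeft, swap_mul_self_mul] at h
    rw [two_mul]
    nth_rewrite 1 [← h]
    rw [← sum_add_distrib, ← sum_neg_distrib]
    refine sum_congr rfl fun σ _ => ?_
    rw [entropyProduction]
    ring
  have e1 : ∑ σ, Real.log (f σ) * generator f σ
      = ∑ a, ∑ b, ∑ σ, Real.log (f σ) * (f (swap a b * σ) - f σ) := by
    simp only [generator, mul_sum]
    rw [sum_comm]
    exact sum_congr rfl fun a _ => sum_comm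
  have e2 : dissipation f = ∑ a, ∑ b, ∑ σ, entropyProduction (f σ) (f (swap a b * σ)) := by
    rw [dissipation, sum_comm]
    exact sum_congr rfl fun a _ => sum_comm
  rw [e1, e2, mul_sum, ← sum_neg_distrib]
  refine sum_congr rfl fun a _ => ?_
  rw [mul_sum, ← sum_neg_distrib]
  exact sum_congr rfl fun b _ => key a b

/-- If neither preimage of `a`, `b` lies in `Q`, then `swap a b * σ` is `σ` times an element of
`fixing Q`, so the average does not change and nothing is dissipated. The other terms are bounded by
joint convexity. -/
lemma dissipation_condAvg_le (Q : Finset α) {f : Perm α → ℝ} (hf : ∀ σ, 0 < f σ) :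
    dissipation (condAvg Q f) ≤ ∑ σ, ∑ a, ∑ b,
      if σ.symm a ∈ Q ∨ σ.symm b ∈ Q then entropyProduction (f σ) (f (swap a b * σ)) else 0 := by
  set W : Perm α → ℝ := fun σ => ∑ a, ∑ b,
    if σ.symm a ∈ Q ∨ σ.symm b ∈ Q then entropyProduction (f σ) (f (swap a b * σ)) else 0 with hW
  have h1 : ∀ σ, ∑ a, ∑ b, entropyProduction (condAvg Q f σ) (condAvg Q f (swap a b * σ))
      ≤ condAvg Q W σ := by
    intro σ
    simp only [hW, condAvg, expect_sum_comm]
    refine sum_le_sum fun a _ => sum_le_sum fun b _ => ?_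
    by_cases hab : σ.symm a ∈ Q ∨ σ.symm b ∈ Q
    · have : ∀ π ∈ fixing Q, (if (σ * π).symm a ∈ Q ∨ (σ * π).symm b ∈ Q then
          entropyProduction (f (σ * π)) (f (swap a b * (σ * π))) else 0)
          = entropyProduction (f (σ * π)) (f (swap a b * σ * π)) := by
        intro π hπ
        have e : ∀ c, (σ * π).symm c ∈ Q ↔ σ.symm c ∈ Q := fun c => by
          rw [← mem_of_mem_fixing hπ]
          simp [Perm.mul_def]
        rw [if_pos (by rwa [e, e]), mul_assoc]
      rw [expect_congr rfl this]
      exact entropyProduction_expect_le (fixing_nonempty Q) (fun _ => hf _) (fun _ => hf _)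
    · push Not at hab
      have e : swap a b * σ = σ * swap (σ.symm a) (σ.symm b) := by
        rw [mul_swap_eq_swap_mul]; simp
      have hfix : swap (σ.symm a) (σ.symm b) ∈ fixing Q := mem_fixing.2 fun x hx =>
        swap_apply_of_ne_of_ne (fun h => hab.1 (h ▸ hx)) (fun h => hab.2 (h ▸ hx))
      have e2 : 𝔼 π ∈ fixing Q, f (swap a b * σ * π) = 𝔼 π ∈ fixing Q, f (σ * π) := by
        rw [e]; exact condAvg_mul_right hfix σ
      rw [e2, entropyProduction_self]
      refine expect_nonneg fun π _ => ?_
      split_ifs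
      · exact entropyProduction_nonneg (hf _) (hf _)
      · exact le_rfl
  rw [dissipation, ← sum_condAvg Q W]
  exact sum_le_sum fun σ _ => h1 σ

/-- Each pair `a`, `b` is charged only for those `d` whose set contains one of two points, each of
which lies in at most `c` sets. -/
lemma sum_dissipation_condAvg_le {D : Type*} [Fintype D] (Q : D → Finset α) {c : ℝ}
    (hc : ∀ i, ((univ.filter fun d => i ∈ Q d).card : ℝ) ≤ c) {f : Perm α → ℝ}
    (hf : ∀ σ, 0 < f σ) :
    ∑ d, dissipation (condAvg (Q d) f) ≤ 2 * c * dissipation f := by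
  classical
  refine (sum_le_sum fun d _ => dissipation_condAvg_le (Q d) hf).trans ?_
  rw [dissipation, sum_comm, mul_sum]
  refine sum_le_sum fun σ _ => ?_
  rw [sum_comm, mul_sum]
  refine sum_le_sum fun a _ => ?_
  rw [sum_comm, mul_sum]
  refine sum_le_sum fun b _ => ?_
  rw [← sum_filter, sum_const, nsmul_eq_mul]
  refine mul_le_mul_of_nonneg_right ?_ (entropyProduction_nonneg (hf _) (hf _))
  rw [filter_or]
  have := card_union_le (univ.filter fun d => σ.symm a ∈ Q d) (univ.filter fun d => σ.symm b ∈ Q d)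
  have h' : (((univ.filter fun d => σ.symm a ∈ Q d) ∪
    (univ.filter fun d => σ.symm b ∈ Q d)).card : ℝ) ≤
    ((univ.filter fun d => σ.symm a ∈ Q d).card : ℝ) + (univ.filter fun d => σ.symm b ∈ Q d).card :=
    by exact_mod_cast this
  linarith [hc (σ.symm a), hc (σ.symm b)]

lemma eq_of_dissipation_nonpos {f : Perm α → ℝ} (hf : ∀ σ, 0 < f σ) (h : dissipation f ≤ 0)
    (σ : Perm α) : f σ = f 1 := by
  have hinv : ∀ σ a b, f (swap a b * σ) = f σ := by
    intro σ a b
    by_contra hne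
    refine absurd h (not_le.2 ?_)
    have h0 : ∀ σ a b, 0 ≤ entropyProduction (f σ) (f (swap a b * σ)) := fun σ a b =>
      entropyProduction_nonneg (hf _) (hf _)
    refine sum_pos' (fun σ _ => sum_nonneg fun a _ => sum_nonneg fun b _ => h0 σ a b)
      ⟨σ, mem_univ _, sum_pos' (fun a _ => sum_nonneg fun b _ => h0 σ a b)
        ⟨a, mem_univ _, sum_pos' (fun b _ => h0 σ a b) ⟨b, mem_univ _, ?_⟩⟩⟩
    exact entropyProduction_pos (hf _) (hf _) (Ne.symm hne)
  induction σ using Perm.swap_induction_on with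
  | one => rfl
  | swap_mul σ a b _ ih => rw [hinv, ih]

end PermChallenge
namespace PermChallenge
open Finset Equiv
variable {α : Type*} [Fintype α] [DecidableEq α]

/-! ### From dissipation to entropy by minimisation over densities. -/

lemma hasDerivAt_sum_mul_log (f : Perm α → ℝ) (hf : ∀ σ, 0 < f σ) (hsum : ∑ σ, generator f σ = 0) :
    HasDerivAt (fun t : ℝ => ∑ σ, (f σ + t * generator f σ) * Real.log (f σ + t * generator f σ))
      (-(dissipation f) / 2) 0 := by
  have h : ∀ σ, HasDerivAt
      (fun t : ℝ => (f σ + t * generator f σ) * Real.log (f σ + t * generator f σ))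
      ((Real.log (f σ) + 1) * generator f σ) 0 := by
    intro σ
    have h1 : HasDerivAt (fun t : ℝ => f σ + t * generator f σ) (generator f σ) 0 := by
      simpa using ((hasDerivAt_id (0 : ℝ)).mul_const (generator f σ)).const_add (f σ)
    have h2 : HasDerivAt (fun x : ℝ => x * Real.log x) (Real.log (f σ) + 1)
        (f σ + 0 * generator f σ) := by
      simpa using Real.hasDerivAt_mul_log (hf σ).ne'
    exact h2.comp (0 : ℝ) h1
  have h3 := HasDerivAt.fun_sum fun σ (_ : σ ∈ (univ : Finset (Perm α))) => h σ
  refine h3.congr_deriv ?_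
  simp only [add_mul, one_mul, sum_add_distrib, hsum]
  linarith [two_mul_sum_log_mul_generator f]

lemma generator_eq (f : Perm α → ℝ) (σ : Perm α) :
    generator f σ = ∑ a, ∑ b, f (swap a b * σ) - (Fintype.card α : ℝ) ^ 2 * f σ := by
  simp [generator, sum_sub_distrib]
  ring

/-- The functions on the symmetric group with average one that are bounded below by `ε`. -/
def densities (α : Type*) [Fintype α] [DecidableEq α] (ε : ℝ) : Set (Perm α → ℝ) :=
  {f | (∀ σ, ε ≤ f σ) ∧ ∑ σ, f σ = Fintype.card (Perm α)}

lemma isCompact_densities {ε : ℝ} (hε : 0 ≤ ε) : IsCompact (densities α ε) := by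
  have h : IsCompact (Set.pi Set.univ fun _ : Perm α =>
      Set.Icc (0 : ℝ) (Fintype.card (Perm α))) := isCompact_univ_pi fun _ => isCompact_Icc
  refine h.of_isClosed_subset ?_ ?_
  · have : densities α ε = (⋂ σ, {f : Perm α → ℝ | ε ≤ f σ}) ∩
        {f : Perm α → ℝ | ∑ σ, f σ = Fintype.card (Perm α)} := by
      ext f; simp [densities]
    rw [this]
    refine (isClosed_iInter fun σ => isClosed_le continuous_const (continuous_apply σ)).inter ?_
    exact isClosed_eq (by fun_prop) continuous_const
  · rintro f ⟨h1, h2⟩ σ -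
    refine ⟨hε.trans (h1 σ), ?_⟩
    rw [← h2]
    exact single_le_sum (fun τ _ => hε.trans (h1 τ)) (mem_univ σ)

/-- For such `t` the new function is a convex combination of `f` and its translates by
transpositions. -/
lemma add_mul_generator_mem_densities {ε : ℝ} {f : Perm α → ℝ}
    (hf : f ∈ densities α ε) {t : ℝ} (ht : 0 ≤ t) (ht' : t * (Fintype.card α : ℝ) ^ 2 ≤ 1) :
    (fun σ => f σ + t * generator f σ) ∈ densities α ε := by
  refine ⟨fun σ => ?_, ?_⟩
  · have h1 : (Fintype.card α : ℝ) ^ 2 * ε ≤ ∑ a, ∑ b, f (swap a b * σ) := by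
      calc (Fintype.card α : ℝ) ^ 2 * ε = ∑ _a : α, ∑ _b : α, ε := by simp; ring
        _ ≤ _ := sum_le_sum fun a _ => sum_le_sum fun b _ => hf.1 _
    have h2 := mul_le_mul_of_nonneg_left h1 ht
    have h3 := mul_le_mul_of_nonneg_left (hf.1 σ) (sub_nonneg.2 ht')
    simp only [generator_eq]
    nlinarith
  · rw [sum_add_distrib, ← mul_sum, sum_generator, hf.2]; simp

variable {D : Type*} [Fintype D]

lemma continuous_condAvg (Q : Finset α) : Continuous (condAvg Q) := by
  refine continuous_pi fun σ => ?_
  simp only [condAvg, expect]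
  fun_prop

lemma continuous_sum_mul_log : Continuous fun f : Perm α → ℝ => ∑ σ, f σ * Real.log (f σ) :=
  continuous_finsetSum _ fun σ _ => Real.continuous_mul_log.comp (continuous_apply σ)

/-- The floor `ε` keeps the entropies differentiable at the minimiser; the strict inequality `2 * c
< k` forces its dissipation to vanish. -/
lemma sum_entropy_condAvg_le_of_lt (Q : D → Finset α) {c k : ℝ}
    (hc : ∀ i, ((univ.filter fun d => i ∈ Q d).card : ℝ) ≤ c) (hk : 2 * c < k) {ε : ℝ}
    (hε : 0 < ε) {f : Perm α → ℝ} (hf : f ∈ densities α ε) :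
    ∑ d, ∑ σ, condAvg (Q d) f σ * Real.log (condAvg (Q d) f σ)
      ≤ k * ∑ σ, f σ * Real.log (f σ) := by
  set Ψ : (Perm α → ℝ) → ℝ := fun f => k * ∑ σ, f σ * Real.log (f σ)
    - ∑ d, ∑ σ, condAvg (Q d) f σ * Real.log (condAvg (Q d) f σ) with hΨ
  have hcont : Continuous Ψ := (continuous_const.mul continuous_sum_mul_log).sub
    (continuous_finsetSum _ fun d _ => continuous_sum_mul_log.comp (continuous_condAvg (Q d)))
  obtain ⟨g, hg, hmin⟩ := (isCompact_densities hε.le).exists_isMinOn ⟨f, hf⟩ hcont.continuousOn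
  have hpos : ∀ σ, 0 < g σ := fun σ => hε.trans_le (hg.1 σ)
  suffices h : Ψ g = 0 by
    have := hmin hf
    simp only [Set.mem_ofPred_eq, h] at this
    simp only [hΨ] at this
    linarith
  have hder : HasDerivAt (fun t : ℝ => Ψ fun σ => g σ + t * generator g σ)
      (k * (-(dissipation g) / 2) - ∑ d, -(dissipation (condAvg (Q d) g)) / 2) 0 := by
    refine ((hasDerivAt_sum_mul_log g hpos (sum_generator g)).const_mul k).sub
      (HasDerivAt.fun_sum fun d _ => ?_)
    have := hasDerivAt_sum_mul_log (condAvg (Q d) g) (condAvg_pos hpos) (sum_generator _)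
    simpa only [condAvg_add_smul, condAvg_generator] using this
  set t₀ : ℝ := 1 / ((Fintype.card α : ℝ) ^ 2 + 1) with ht₀
  have ht₀pos : 0 < t₀ := by positivity
  have hnn : 0 ≤ k * (-(dissipation g) / 2) - ∑ d, -(dissipation (condAvg (Q d) g)) / 2 := by
    have hloc : IsMinOn (fun t : ℝ => Ψ fun σ => g σ + t * generator g σ) (Set.Icc 0 t₀) 0 := by
      intro t ht
      have hm := add_mul_generator_mem_densities hg ht.1 (t := t) (by
        have h1 : t * (Fintype.card α : ℝ) ^ 2 ≤ t₀ * (Fintype.card α : ℝ) ^ 2 :=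
          mul_le_mul_of_nonneg_right ht.2 (by positivity)
        refine h1.trans ?_
        rw [ht₀, one_div, inv_mul_le_iff₀ (by positivity)]
        linarith)
      simpa using hmin hm
    -- Only `t ≥ 0` stays among the densities, so the minimum gives a one-sided derivative
    -- condition.
    have hy : t₀ ∈ posTangentConeAt (Set.Icc 0 t₀) (0 : ℝ) := by
      refine mem_posTangentConeAt_of_segment_subset ?_
      rw [zero_add, segment_eq_Icc ht₀pos.le]
    have := hloc.localize.hasFDerivWithinAt_nonneg hder.hasFDerivAt.hasFDerivWithinAt hy
    simp only [ContinuousLinearMap.toSpanSingleton_apply, smul_eq_mul] at this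
    exact nonneg_of_mul_nonneg_right this ht₀pos
  have hle := sum_dissipation_condAvg_le Q hc hpos
  rw [← sum_div, sum_neg_distrib] at hnn
  -- Combining `hnn` and `hle` gives `k * dissipation g ≤ 2 * c * dissipation g`.
  have hd : dissipation g ≤ 0 := by
    by_contra hlt
    nlinarith
  have hconst := eq_of_dissipation_nonpos hpos hd
  have hone : g = fun _ => 1 := by
    have h2 := hg.2
    rw [sum_congr rfl fun σ _ => hconst σ] at h2
    simp only [sum_const, card_univ, nsmul_eq_mul] at h2
    have h3 : g 1 = 1 := by
      have : (Fintype.card (Perm α) : ℝ) ≠ 0 := by exact_mod_cast Fintype.card_ne_zero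
      exact mul_left_cancel₀ this (by rw [h2, mul_one])
    ext σ
    rw [hconst, h3]
  have hcond : ∀ d, condAvg (Q d) (fun _ => (1 : ℝ)) = fun _ => 1 := fun d => by
    ext σ; exact expect_const (fixing_nonempty _) _
  simp [hΨ, hone, hcond]

/-- **Shearer's inequality for the symmetric group**, for densities relative to the uniform
measure. -/
theorem sum_entropy_condAvg_le (Q : D → Finset α) {c : ℝ}
    (hc : ∀ i, ((univ.filter fun d => i ∈ Q d).card : ℝ) ≤ c) {f : Perm α → ℝ}
    (hf : f ∈ densities α 0) :
    ∑ d, ∑ σ, condAvg (Q d) f σ * Real.log (condAvg (Q d) f σ)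
      ≤ 2 * c * ∑ σ, f σ * Real.log (f σ) := by
  -- Mixing with the constant density gives the floor `t`. The same `t` serves as slack in `k = 2 *
  -- c + t`, and both disappear as `t → 0`, since `x log x` is continuous at 0.
  set F : ℝ → Perm α → ℝ := fun t σ => f σ + t * (1 - f σ) with hF
  have hFc : Continuous F := by fun_prop
  have h1 : ∀ t ∈ Set.Ioo (0 : ℝ) 1,
      ∑ d, ∑ σ, condAvg (Q d) (F t) σ * Real.log (condAvg (Q d) (F t) σ)
      ≤ (2 * c + t) * ∑ σ, F t σ * Real.log (F t σ) := by
    intro t ht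
    refine sum_entropy_condAvg_le_of_lt Q hc (by linarith [ht.1]) ht.1 ⟨fun σ => ?_, ?_⟩
    · have := mul_nonneg (sub_nonneg.2 ht.2.le) (hf.1 σ)
      simp only [hF]; linarith
    · simp [hF, sum_add_distrib, ← mul_sum, sum_sub_distrib, hf.2]
  have hF0 : F 0 = f := by ext σ; simp [hF]
  have hl : Continuous fun t => ∑ d, ∑ σ, condAvg (Q d) (F t) σ *
      Real.log (condAvg (Q d) (F t) σ) := continuous_finsetSum _ fun d _ =>
    continuous_sum_mul_log.comp ((continuous_condAvg (Q d)).comp hFc)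
  have hr : Continuous fun t => (2 * c + t) * ∑ σ, F t σ * Real.log (F t σ) :=
    (continuous_const.add continuous_id).mul (continuous_sum_mul_log.comp hFc)
  have := le_of_tendsto_of_tendsto (b := nhdsWithin (0 : ℝ) (Set.Ioi 0))
    ((hl.tendsto 0).mono_left nhdsWithin_le_nhds) ((hr.tendsto 0).mono_left nhdsWithin_le_nhds)
    (Filter.eventually_of_mem (Ioo_mem_nhdsGT one_pos) h1)
  simpa [hF0] using this

end PermChallenge
namespace PermChallenge
open Finset Equiv

/-! ### Bounds on moment generating functions and the change of measure -/

/-- The logarithm of the moment generating function at `l` of a Bernoulli variable with mean `q`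
is at most `a * q + b`. -/
def LogMGFBound (l a b : ℝ) : Prop :=
  ∀ q : ℝ, 0 ≤ q → q ≤ 1 → Real.log (1 + q * (Real.exp l - 1)) ≤ a * q + b

/-- Uses `log (1 + x) ≤ x` and `e - 1 ≤ 2`. -/
lemma logMGFBound_one : LogMGFBound 1 2 0 := by
  intro q hq _
  have h := Real.exp_one_lt_three
  have h1 := Real.add_one_le_exp (1 : ℝ)
  have h2 := Real.log_le_sub_one_of_pos
    (show 0 < 1 + q * (Real.exp 1 - 1) by nlinarith)
  nlinarith

/-- The Bernoulli moment generating function is `exp (l * q)` times the centred one, to which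
Hoeffding's lemma on `[0, 1]` applies. -/
lemma logMGFBound_hoeffding (l : ℝ) : LogMGFBound l l (l ^ 2 / 8) := by
  intro q hq hq1
  have hpos : 0 < 1 + q * (Real.exp l - 1) := by
    rcases hq.eq_or_lt with rfl | h
    · norm_num
    · nlinarith [mul_pos h (Real.exp_pos l)]
  let μ : MeasureTheory.Measure Bool :=
    ProbabilityTheory.bernoulliMeasure true false ⟨q, hq, hq1⟩
  let X : Bool → ℝ := fun x => if x then 1 else 0
  have hint : ∀ F : Bool → ℝ, ∫ x, F x ∂μ = q * F true + (1 - q) * F false := by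
    intro F
    simp [μ, ProbabilityTheory.integral_bernoulliMeasure]
  have h := (ProbabilityTheory.hasSubgaussianMGF_of_mem_Icc (μ := μ) (X := X) (a := 0) (b := 1)
    (by fun_prop) (Filter.Eventually.of_forall fun x => by cases x <;> simp [X])).mgf_le l
  rw [ProbabilityTheory.mgf, hint, hint] at h
  rw [Real.log_le_iff_le_exp hpos]
  have e : 1 + q * (Real.exp l - 1) = Real.exp (l * q) *
      (q * Real.exp (l * (1 - q)) + (1 - q) * Real.exp (l * (0 - q))) := by
    rw [mul_add, mul_left_comm, mul_left_comm _ (1 - q), ← Real.exp_add, ← Real.exp_add]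
    rw [show l * q + l * (1 - q) = l by ring, show l * q + l * (0 - q) = 0 by ring, Real.exp_zero]
    ring
  rw [e, Real.exp_add]
  refine mul_le_mul_of_nonneg_left ?_ (Real.exp_pos _).le
  simp [X] at h
  norm_num at h ⊢
  rwa [show 1 / 4 * l ^ 2 / 2 = l ^ 2 / 8 by ring] at h

/-- The Gibbs (Donsker–Varadhan) variational principle, scaled by the number of points. It follows
pointwise from `log x ≤ x - 1`. -/
lemma sum_mul_le_entropy {Ω : Type*} [Fintype Ω] [Nonempty Ω] {g : Ω → ℝ} (hg : ∀ ω, 0 ≤ g ω)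
    (hsum : ∑ ω, g ω = Fintype.card Ω) (X : Ω → ℝ) :
    ∑ ω, g ω * X ω ≤ ∑ ω, g ω * Real.log (g ω)
      + Fintype.card Ω * Real.log (𝔼 ω, Real.exp (X ω)) := by
  set m := 𝔼 ω, Real.exp (X ω) with hm
  have hm0 : 0 < m := expect_pos (fun _ _ => Real.exp_pos _) univ_nonempty
  have hpt : ∀ ω, g ω * X ω ≤ g ω * Real.log (g ω) + g ω * Real.log m - g ω
      + Real.exp (X ω) / m := by
    intro ω
    rcases (hg ω).eq_or_lt with h | h
    · rw [← h]; simp only [zero_mul, sub_zero, zero_add]; positivity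
    · have h1 := Real.log_le_sub_one_of_pos (show 0 < Real.exp (X ω) / m / g ω by positivity)
      rw [Real.log_div (by positivity) h.ne', Real.log_div (by positivity) hm0.ne',
        Real.log_exp] at h1
      have h2 := mul_le_mul_of_nonneg_left h1 h.le
      have h3 : g ω * (Real.exp (X ω) / m / g ω - 1) = Real.exp (X ω) / m - g ω := by
        field_simp
      linarith
  have hexp : ∑ ω, Real.exp (X ω) / m = Fintype.card Ω := by
    rw [← sum_div, ← Fintype.card_mul_expect, ← hm, mul_div_cancel_right₀ _ hm0.ne']
  calc _ ≤ _ := sum_le_sum fun ω _ => hpt ω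
    _ = _ := by
      rw [sum_add_distrib, sum_sub_distrib, sum_add_distrib, ← sum_mul, hsum, hexp]
      ring

lemma log_expect_exp_le {Ω : Type*} [Fintype Ω] [Nonempty Ω] {l a b : ℝ} (h : LogMGFBound l a b)
    {X : Ω → ℝ} (hX : ∀ ω, X ω = 0 ∨ X ω = 1) :
    Real.log (𝔼 ω, Real.exp (l * X ω)) ≤ a * 𝔼 ω, X ω + b := by
  have e : ∀ ω, Real.exp (l * X ω) = 1 + X ω * (Real.exp l - 1) := fun ω => by
    rcases hX ω with h | h <;> simp [h]
  simp_rw [e]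
  rw [expect_add_distrib, ← expect_mul, expect_const univ_nonempty]
  refine h _ (expect_nonneg fun ω _ => ?_) (expect_le univ_nonempty fun ω _ => ?_)
  · rcases hX ω with h | h <;> simp [h]
  · rcases hX ω with h | h <;> simp [h]

section
variable {α : Type*} [Fintype α] [DecidableEq α] {D : Type*} [Fintype D] [Nonempty D]

/-- Comparison of a uniform element of `X` with a uniform permutation for events `s d` that depend
only on the values on `Q d`. -/
lemma expect_mem_le (Q : D → Finset α) {c : ℝ}
    (hc : ∀ i, ((univ.filter fun d => i ∈ Q d).card : ℝ) ≤ c) {l a b : ℝ}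
    (h : LogMGFBound l a b) (X : Finset (Perm α)) (hX : X.Nonempty) (s : D → Perm α → ℝ)
    (hs : ∀ d σ, s d σ = 0 ∨ s d σ = 1)
    (hinv : ∀ d σ, ∀ π ∈ fixing (Q d), s d (σ * π) = s d σ) :
    l * 𝔼 σ ∈ X, 𝔼 d, s d σ ≤ a * 𝔼 σ, 𝔼 d, s d σ + b
      + 2 * c / Fintype.card D * Real.log (Fintype.card (Perm α) / X.card) := by
  set n : ℝ := (Fintype.card (Perm α) : ℝ) with hn
  have hn0 : 0 < n := by simp only [hn]; exact_mod_cast Fintype.card_pos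
  have hx0 : (0 : ℝ) < X.card := by exact_mod_cast hX.card_pos
  have hD0 : (0 : ℝ) < Fintype.card D := by exact_mod_cast Fintype.card_pos
  -- The density of the uniform law on `X`; its entropy is the deficit `log (n / |X|)`, scaled by
  -- `n`.
  set f : Perm α → ℝ := fun σ => if σ ∈ X then n / X.card else 0 with hf
  have hfnn : ∀ σ, 0 ≤ f σ := fun σ => by simp only [hf]; split_ifs <;> positivity
  have hfsum : ∑ σ, f σ = n := by
    simp only [hf, sum_ite_mem, univ_inter, sum_const, nsmul_eq_mul]
    field_simp
  have hent : ∑ σ, f σ * Real.log (f σ) = n * Real.log (n / X.card) := by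
    have : ∀ σ, f σ * Real.log (f σ) =
        if σ ∈ X then n / X.card * Real.log (n / X.card) else 0 := fun σ => by
      simp only [hf]; split_ifs <;> simp
    simp only [this, sum_ite_mem, univ_inter, sum_const, nsmul_eq_mul]
    field_simp
  have hsh := sum_entropy_condAvg_le Q hc (f := f) ⟨hfnn, hfsum⟩
  rw [hent] at hsh
  have hd : ∀ d, l * (n * 𝔼 σ ∈ X, s d σ)
      ≤ ∑ σ, condAvg (Q d) f σ * Real.log (condAvg (Q d) f σ) + n * (a * 𝔼 σ, s d σ + b) := by
    intro d
    have h1 := sum_mul_le_entropy (condAvg_nonneg hfnn) ((sum_condAvg (Q d) f).trans hfsum)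
      fun σ => l * s d σ
    -- The event `s d` only sees the values on `Q d`, so its mean under the averaged density equals
    -- its mean under `f`. Only the smaller entropy of the marginal is paid.
    rw [sum_condAvg_mul f _ fun σ π hπ => by rw [hinv d σ π hπ]] at h1
    have h2 := mul_le_mul_of_nonneg_left (log_expect_exp_le h (hs d)) hn0.le
    have h3 : ∑ σ, f σ * (l * s d σ) = l * (n * 𝔼 σ ∈ X, s d σ) := by
      simp only [hf, ite_mul, zero_mul, sum_ite_mem, univ_inter, expect_eq_sum_div_card, mul_sum,
        sum_div]
      exact sum_congr rfl fun σ _ => by ring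
    rw [h3] at h1
    linarith
  have hsumd := (sum_le_sum fun d (_ : d ∈ univ) => hd d)
  rw [sum_add_distrib, ← mul_sum, ← mul_sum, ← mul_sum, sum_add_distrib, ← mul_sum, sum_const,
    card_univ, nsmul_eq_mul] at hsumd
  rw [expect_comm, expect_comm (s := univ) (t := univ)]
  rw [← Fintype.card_mul_expect fun d => 𝔼 σ ∈ X, s d σ,
    ← Fintype.card_mul_expect fun d => 𝔼 σ, s d σ] at hsumd
  set P := 𝔼 d, 𝔼 σ ∈ X, s d σ
  set R := 𝔼 d, 𝔼 σ, s d σ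
  set L := Real.log (n / X.card)
  have hfin : n * Fintype.card D * (l * P)
      ≤ n * Fintype.card D * (a * R + b + 2 * c / Fintype.card D * L) := by
    have : n * Fintype.card D * (a * R + b + 2 * c / Fintype.card D * L)
      = 2 * c * (n * L) + n * (a * (Fintype.card D * R) + Fintype.card D * b) := by
      field_simp
      ring
    rw [this]
    linarith
  exact le_of_mul_le_mul_left hfin (by positivity)

/-! ### Permutations with prescribed values on a set. -/

/-- The permutations that agree with `σ` on `E`. -/
def agreeing (E : Finset α) (σ : Perm α) : Finset (Perm α) :=
  univ.filter fun τ => ∀ x ∈ E, τ x = σ x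

lemma mem_agreeing {E : Finset α} {σ τ : Perm α} : τ ∈ agreeing E σ ↔ ∀ x ∈ E, τ x = σ x := by
  simp [agreeing]

/-- The permutation that agrees with `σ` on `E` and with `σ` after `π` outside `E`. -/
def extend {β : Type*} [DecidableEq β] (E : Finset β) (σ : Perm β) : Perm {x // x ∉ E} ↪ Perm β :=
  ⟨fun π => σ * Perm.ofSubtype π, fun _ _ h => Perm.ofSubtype_injective (mul_left_cancel h)⟩

lemma extend_eq {β : Type*} [DecidableEq β] (E : Finset β) (σ : Perm β) (π : Perm {x // x ∉ E}) :
    extend E σ π = σ * Perm.ofSubtype π := rfl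

lemma extend_apply_of_mem {β : Type*} [DecidableEq β] {E : Finset β} (σ : Perm β)
    (π : Perm {x // x ∉ E}) {x : β}
    (hx : x ∈ E) : extend E σ π x = σ x := by
  rw [extend_eq, Perm.mul_apply, Perm.ofSubtype_apply_of_not_mem π (not_not.2 hx)]

lemma map_extend_univ (E : Finset α) (σ : Perm α) : univ.map (extend E σ) = agreeing E σ := by
  ext τ
  simp only [mem_map, mem_univ, true_and, mem_agreeing]
  constructor
  · rintro ⟨π, rfl⟩ x hx
    exact extend_apply_of_mem σ π hx
  · intro h
    have hfix : ∀ x ∈ E, (σ⁻¹ * τ) x = x := fun x hx => by simp [h x hx]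
    have h1 : ∀ x, (σ⁻¹ * τ) x ∉ E ↔ x ∉ E := fun x => not_congr
      (mem_of_mem_fixing (mem_fixing.2 hfix) x)
    refine ⟨Perm.subtypePerm (σ⁻¹ * τ) h1, ?_⟩
    have h2 := Perm.ofSubtype_subtypePerm h1 fun x hx hxE => hx (hfix x hxE)
    rw [extend_eq]
    convert mul_inv_cancel_left σ τ
    convert h2

lemma expect_map {ι κ : Type*} (e : ι ↪ κ) (s : Finset ι) (F : κ → ℝ) :
    𝔼 i ∈ s.map e, F i = 𝔼 i ∈ s, F (e i) := by
  simp [expect_eq_sum_div_card]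

/-- The class is a copy of the symmetric group on the complement of `E`. Replacing each `Q d` by its
part outside `E` does not increase the covering number. -/
lemma expect_mem_agreeing_le (E : Finset α) (ρ : Perm α) (Q : D → Finset α) {c : ℝ}
    (hc : ∀ i, ((univ.filter fun d => i ∈ Q d).card : ℝ) ≤ c) {l a b : ℝ}
    (h : LogMGFBound l a b) {X : Finset (Perm α)} (hX : X.Nonempty) (hXE : X ⊆ agreeing E ρ)
    (s : D → Perm α → ℝ) (hs : ∀ d σ, s d σ = 0 ∨ s d σ = 1)
    (hinv : ∀ d σ τ, (∀ x ∈ Q d, σ x = τ x) → s d σ = s d τ) :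
    l * 𝔼 σ ∈ X, 𝔼 d, s d σ ≤ a * 𝔼 σ ∈ agreeing E ρ, 𝔼 d, s d σ + b
      + 2 * c / Fintype.card D * Real.log ((agreeing E ρ).card / X.card) := by
  obtain ⟨Y, hY⟩ : ∃ Y : Finset (Perm {x // x ∉ E}), X = Y.map (extend E ρ) := by
    rw [← map_extend_univ] at hXE
    obtain ⟨Y, -, hY⟩ := subset_map_iff.1 hXE
    exact ⟨Y, hY⟩
  subst hY
  rw [← map_extend_univ, expect_map, expect_map, card_map, card_map, card_univ]
  refine expect_mem_le (fun d => (Q d).subtype (· ∉ E)) (fun i => ?_) h Y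
    (map_nonempty.1 hX) (fun d π => s d (extend E ρ π)) (fun d π => hs d _) ?_
  · simpa using hc i
  · intro d σ π hπ
    refine hinv d _ _ fun x hx => ?_
    by_cases hxE : x ∈ E
    · rw [extend_apply_of_mem _ _ hxE, extend_apply_of_mem _ _ hxE]
    · have h1 : π ⟨x, hxE⟩ = ⟨x, hxE⟩ := mem_fixing.1 hπ _ (by simpa using hx)
      have h2 : Perm.ofSubtype π x = x := by
        rw [Perm.ofSubtype_apply_of_mem π hxE, h1]
      rw [extend_eq, extend_eq, map_mul, Perm.mul_apply, Perm.mul_apply, Perm.mul_apply, h2]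

end

end PermChallenge
namespace PermChallenge
open Finset Equiv

/-! ### Averaging over the advice and the answers to the inner queries -/

section

lemma sum_inv_card_class_le {Ω : Type*} [Fintype Ω] (X : Ω → Finset Ω) (s : Finset Ω)
    (hs : ∀ σ ∈ s, ∀ τ ∈ s, τ ∈ X σ) : ∑ σ ∈ s, ((X σ).card : ℝ)⁻¹ ≤ 1 := by
  rcases s.eq_empty_or_nonempty with rfl | hne
  · simp
  have h0 : (0 : ℝ) < s.card := by exact_mod_cast hne.card_pos
  calc ∑ σ ∈ s, ((X σ).card : ℝ)⁻¹ ≤ ∑ σ ∈ s, (s.card : ℝ)⁻¹ := by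
        refine sum_le_sum fun σ hσ => inv_anti₀ h0 ?_
        exact_mod_cast card_le_card fun τ hτ => hs σ hσ τ hτ
    _ = 1 := by rw [sum_const, nsmul_eq_mul, mul_inv_cancel₀ h0.ne']

variable {Ω : Type*} [Fintype Ω]

/-- The classes partition `Ω`, and resampling a uniform point within its class leaves it uniform. -/
lemma expect_expect_class (X : Ω → Finset Ω) (hrefl : ∀ σ, σ ∈ X σ)
    (hX : ∀ σ τ, τ ∈ X σ → X τ = X σ) (F : Ω → ℝ) : 𝔼 σ, 𝔼 τ ∈ X σ, F τ = 𝔼 σ, F σ := by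
  classical
  simp only [expect_eq_sum_div_card]
  congr 1
  have hsymm : ∀ σ τ, τ ∈ X σ ↔ σ ∈ X τ := fun σ τ =>
    ⟨fun h => hX σ τ h ▸ hrefl σ, fun h => hX τ σ h ▸ hrefl τ⟩
  calc ∑ σ, (∑ τ ∈ X σ, F τ) / (X σ).card
      = ∑ σ, ∑ τ, if τ ∈ X σ then F τ / (X τ).card else 0 := by
        refine sum_congr rfl fun σ _ => ?_
        rw [sum_ite_mem, univ_inter, sum_div]
        exact sum_congr rfl fun τ hτ => by rw [hX σ τ hτ]
    _ = ∑ τ, ∑ σ, if τ ∈ X σ then F τ / (X τ).card else 0 := sum_comm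
    _ = ∑ τ, F τ := by
        refine sum_congr rfl fun τ _ => ?_
        simp only [hsymm _ τ, sum_ite_mem, univ_inter, sum_const, nsmul_eq_mul]
        have : ((X τ).card : ℝ) ≠ 0 := by
          exact_mod_cast (card_pos.2 ⟨τ, hrefl τ⟩).ne'
        field_simp

/-- The information that the advice `pre` gives beyond the classes `C z` is at most the logarithm
of the number of advice strings. -/
lemma expect_log_card_div_card_le [Nonempty Ω] {Z : Type*} [Fintype Z] [DecidableEq Z]
    (pre : Ω → Z) (C : Z → Ω → Finset Ω) (hrefl : ∀ z σ, σ ∈ C z σ)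
    (hC : ∀ z σ τ, τ ∈ C z σ → C z τ = C z σ) :
    𝔼 σ, Real.log ((C (pre σ) σ).card / ((C (pre σ) σ).filter fun τ => pre τ = pre σ).card)
      ≤ Real.log (Fintype.card Z) := by
  classical
  set X : Ω → Finset Ω := fun σ => (C (pre σ) σ).filter fun τ => pre τ = pre σ with hXdef
  have hXpos : ∀ σ, 0 < ((X σ).card : ℝ) := fun σ => by
    exact_mod_cast card_pos.2 ⟨σ, by simp [hXdef, hrefl]⟩
  have hCpos : ∀ σ, 0 < ((C (pre σ) σ).card : ℝ) := fun σ => by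
    exact_mod_cast card_pos.2 ⟨σ, hrefl _ _⟩
  have hz0 : 0 < (Fintype.card Z : ℝ) := by
    have : Nonempty Z := ⟨pre (Classical.arbitrary Ω)⟩
    exact_mod_cast Fintype.card_pos
  -- Double counting: for given `τ` and `z`, all `σ` with advice `z` whose class contains `τ` share
  -- one `X`-class, so their weights `1 / |X σ|` add up to at most 1.
  have hsum : ∑ σ, ((C (pre σ) σ).card : ℝ) / (X σ).card ≤ Fintype.card Ω * Fintype.card Z := by
    calc ∑ σ, ((C (pre σ) σ).card : ℝ) / (X σ).card
        = ∑ σ, ∑ τ, if τ ∈ C (pre σ) σ then ((X σ).card : ℝ)⁻¹ else 0 := by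
          refine sum_congr rfl fun σ _ => ?_
          rw [sum_ite_mem, univ_inter, sum_const, nsmul_eq_mul, div_eq_mul_inv]
      _ = ∑ τ, ∑ σ, if τ ∈ C (pre σ) σ then ((X σ).card : ℝ)⁻¹ else 0 := sum_comm
      _ = ∑ τ, ∑ z, ∑ σ ∈ univ.filter (fun σ => pre σ = z),
            if τ ∈ C (pre σ) σ then ((X σ).card : ℝ)⁻¹ else 0 :=
          sum_congr rfl fun τ _ => (sum_fiberwise _ _ _).symm
      _ ≤ ∑ _τ : Ω, ∑ _z : Z, (1 : ℝ) := by
          refine sum_le_sum fun τ _ => sum_le_sum fun z _ => ?_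
          rw [← sum_filter]
          refine sum_inv_card_class_le X _ fun σ hσ ρ hρ => ?_
          simp only [mem_filter, mem_univ, true_and] at hσ hρ
          obtain ⟨rfl, hσ⟩ := hσ
          have hρe := hρ.1
          rw [hρe] at hρ
          have : ρ ∈ C (pre σ) σ := by
            rw [← hC _ _ _ hσ, hC _ _ _ hρ.2]
            exact hrefl _ _
          simp [hXdef, this, hρe]
      _ = _ := by simp
  -- Jensen for the logarithm, through its tangent at `Fintype.card Z`.
  have hpt : ∀ σ, Real.log ((C (pre σ) σ).card / (X σ).card)
      ≤ Real.log (Fintype.card Z) + ((C (pre σ) σ).card / (X σ).card / Fintype.card Z - 1) := by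
    intro σ
    have h0 : 0 < ((C (pre σ) σ).card : ℝ) / (X σ).card := div_pos (hCpos σ) (hXpos σ)
    have := Real.log_le_sub_one_of_pos (div_pos h0 hz0)
    rw [Real.log_div h0.ne' hz0.ne'] at this
    linarith
  refine (expect_le_expect fun σ _ => hpt σ).trans ?_
  rw [expect_add_distrib, expect_sub_distrib, expect_const univ_nonempty,
    expect_const univ_nonempty, ← expect_div, expect_eq_sum_div_card, card_univ]
  have hΩ : 0 < (Fintype.card Ω : ℝ) := by exact_mod_cast Fintype.card_pos
  have : (∑ σ, ((C (pre σ) σ).card : ℝ) / (X σ).card) / Fintype.card Ω / Fintype.card Z ≤ 1 := by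
    rw [div_div, div_le_one (by positivity)]
    exact hsum
  linarith

end

/-! ### The online algorithm and the middle game -/

namespace OnlineAlg

variable {N : ℕ} {M V : Type*}

/-- The inputs of `σ` whose values are learned from the inner queries. -/
def known (A : OnlineAlg N M V) (σ : Perm (Fin N)) : Finset (Fin N) :=
  A.fwd ∪ A.bwd.map σ.symm.toEmbedding

lemma mem_known {A : OnlineAlg N M V} {σ : Perm (Fin N)} {x : Fin N} :
    x ∈ A.known σ ↔ x ∈ A.fwd ∨ σ x ∈ A.bwd := by
  simp [known]

lemma card_known_le (A : OnlineAlg N M V) (σ : Perm (Fin N)) :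
    (A.known σ).card ≤ A.fwd.card + A.bwd.card := by
  simpa [known] using card_union_le A.fwd (A.bwd.map σ.symm.toEmbedding)

lemma symm_eq_of_agree {A : OnlineAlg N M V} {σ τ : Perm (Fin N)}
    (h : ∀ x ∈ A.known σ, τ x = σ x) {y : Fin N} (hy : y ∈ A.bwd) : τ.symm y = σ.symm y := by
  rw [Equiv.symm_apply_eq, h _ (mem_known.2 (Or.inr (by simpa using hy)))]
  simp

/-- With inverse queries the known inputs depend on `σ`. This makes having the same inner answers an
equivalence relation, as the averaging over classes requires. -/
lemma known_eq_of_agree {A : OnlineAlg N M V} {σ τ : Perm (Fin N)}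
    (h : ∀ x ∈ A.known σ, τ x = σ x) : A.known τ = A.known σ := by
  rw [known, known]
  congr 1
  ext x
  simp only [mem_map, Equiv.coe_toEmbedding]
  exact exists_congr fun y => and_congr_right fun hy => by rw [symm_eq_of_agree h hy]

lemma agreeing_known_eq {A : OnlineAlg N M V} {σ τ : Perm (Fin N)}
    (h : τ ∈ agreeing (A.known σ) σ) : agreeing (A.known τ) τ = agreeing (A.known σ) σ := by
  simp only [mem_agreeing] at h
  ext ρ
  simp only [mem_agreeing, known_eq_of_agree h]
  exact forall₂_congr fun x hx => by rw [h x hx]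

/-- The middle game adversary that fixes the answers to the inner queries as in `σ`. -/
noncomputable def midAdversary (A : OnlineAlg N M V) (σ : Perm (Fin N)) : MidAdversary N M V where
  T₁ := (A.known σ).card
  I := (A.known σ).equivFin.symm.toEmbedding.trans (Function.Embedding.subtype _)
  O := ((A.known σ).equivFin.symm.toEmbedding.trans (Function.Embedding.subtype _)).trans
    σ.toEmbedding
  outer := A.outer
  output := A.output (fun x => σ x) fun y => σ.symm y

lemma midAdversary_O (A : OnlineAlg N M V) (σ : Perm (Fin N)) (j) :
    (A.midAdversary σ).O j = σ ((A.midAdversary σ).I j) := rfl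

lemma exists_midAdversary_I {A : OnlineAlg N M V} {σ : Perm (Fin N)} {x : Fin N} :
    (∃ j, (A.midAdversary σ).I j = x) ↔ x ∈ A.known σ := by
  constructor
  · rintro ⟨j, rfl⟩
    exact ((A.known σ).equivFin.symm j).2
  · intro hx
    exact ⟨(A.known σ).equivFin ⟨x, hx⟩,
      congrArg Subtype.val ((A.known σ).equivFin.symm_apply_apply ⟨x, hx⟩)⟩

/-- This can be strict: a forward and an inverse query may reveal the same pair. -/
lemma time_midAdversary_le (A : OnlineAlg N M V) (σ : Perm (Fin N)) :
    (A.midAdversary σ).time ≤ A.queries := by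
  have := A.card_known_le σ
  simp only [MidAdversary.time, queries, midAdversary]
  omega

lemma perms_midAdversary (A : OnlineAlg N M V) (σ : Perm (Fin N)) :
    (A.midAdversary σ).perms = agreeing (A.known σ) σ := by
  ext τ
  have hmem : τ ∈ (A.midAdversary σ).perms
      ↔ ∀ j, τ ((A.midAdversary σ).I j) = σ ((A.midAdversary σ).I j) :=
    mem_filter.trans (and_iff_right (mem_univ _))
  rw [hmem, mem_agreeing]
  constructor
  · intro h x hx
    obtain ⟨j, rfl⟩ := exists_midAdversary_I.2 hx
    exact h j
  · intro h j
    exact h _ (exists_midAdversary_I.1 ⟨j, rfl⟩)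

lemma fixedPairs_midAdversary (A : OnlineAlg N M V) (σ : Perm (Fin N)) :
    (A.midAdversary σ).fixedPairs = {p | p.2 = σ p.1 ∧ p.1 ∈ A.known σ} := by
  ext ⟨x, y⟩
  simp only [MidAdversary.fixedPairs, Set.mem_range, Prod.mk.injEq, midAdversary_O]
  constructor
  · rintro ⟨j, rfl, rfl⟩
    exact ⟨rfl, exists_midAdversary_I.1 ⟨j, rfl⟩⟩
  · rintro ⟨h1, h2⟩
    obtain ⟨j, rfl⟩ := exists_midAdversary_I.2 h2
    exact ⟨j, rfl, h1.symm⟩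

lemma innerView_eq (A : OnlineAlg N M V) (σ : Perm (Fin N)) :
    A.innerView σ = {p | p.2 = σ p.1 ∧ p.1 ∈ A.known σ} := by
  ext ⟨x, y⟩
  change (σ x = y ∧ (x ∈ A.fwd ∨ y ∈ A.bwd)) ↔ (y = σ x ∧ x ∈ A.known σ)
  rw [mem_known]
  constructor
  · rintro ⟨rfl, h⟩; exact ⟨rfl, h⟩
  · rintro ⟨rfl, h⟩; exact ⟨rfl, h⟩

end OnlineAlg

/-! ### Transfer to the middle game and the bound with a free parameter. -/

namespace Game

variable {N : ℕ} {D M V : Type*}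

lemma sucOnline_eq_sucMid (G : Game N D M V) (A : OnlineAlg N M V) {σ τ : Perm (Fin N)}
    (h : τ ∈ agreeing (A.known σ) σ) (d : D) :
    G.sucOnline A τ d = G.sucMid (A.midAdversary σ) τ d := by
  simp only [mem_agreeing] at h
  have h1 : A.innerView τ = (A.midAdversary σ).fixedPairs := by
    rw [A.innerView_eq, A.fixedPairs_midAdversary, OnlineAlg.known_eq_of_agree h]
    ext p
    exact and_congr_left fun hp => by rw [h _ hp]
  have h2 : (fun x : A.fwd => τ x) = fun x : A.fwd => σ x :=
    funext fun x => h x (OnlineAlg.mem_known.2 (Or.inl x.2))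
  have h3 : (fun y : A.bwd => τ.symm y) = fun y : A.bwd => σ.symm y :=
    funext fun y => OnlineAlg.symm_eq_of_agree h y.2
  rw [sucOnline, sucMid, run, h1, h2, h3]
  rfl

lemma sucMid_congr (G : Game N D M V) (B : MidAdversary N M V) (d : D) {σ τ : Perm (Fin N)}
    (h : ∀ m ∈ B.outer, σ (G.tr d m) = τ (G.tr d m)) : G.sucMid B σ d = G.sucMid B τ d := by
  have h1 : ∀ m ∈ B.outer, G.answer σ d m = G.answer τ d m := fun m hm => by
    rw [answer, answer, h m hm]
  have h2 : G.outerView σ d B.outer = G.outerView τ d B.outer := by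
    ext p
    exact and_congr_right fun hp => by rw [h1 _ hp]
  have h3 : (fun m : B.outer => G.answer σ d m) = fun m : B.outer => G.answer τ d m :=
    funext fun m => h1 m m.2
  rw [sucMid, sucMid, h2, h3]

variable [Fintype D]

lemma midSuccessProb_le_one (G : Game N D M V) (B : MidAdversary N M V) :
    G.midSuccessProb B ≤ 1 := by
  have h : ∀ {ι : Type _} (s : Finset ι) (F : ι → ℝ), (∀ i, F i ≤ 1) → 𝔼 i ∈ s, F i ≤ 1 := by
    intro ι s F hF
    rcases s.eq_empty_or_nonempty with rfl | hs
    · simp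
    · exact expect_le hs fun i _ => hF i
  refine h _ _ fun σ => ?_
  rcases (univ : Finset D).eq_empty_or_nonempty with h0 | hs
  · simp [h0]
  · exact expect_le hs fun d _ => by split_ifs <;> simp

lemma midSuccessProb_le_midMaxS (G : Game N D M V) {B : MidAdversary N M V} {T : ℕ}
    (hB : B.time ≤ T) : G.midSuccessProb B ≤ G.midMaxS T :=
  le_csSup ⟨1, by rintro p ⟨B, -, rfl⟩; exact G.midSuccessProb_le_one B⟩ ⟨B, hB, rfl⟩

lemma card_filter_mem_image_tr_le (G : Game N D M V) {u : ℝ} (hG : G.IsUniform u)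
    (U : Finset M) (i : Fin N) :
    ((univ.filter fun d => i ∈ U.image (G.tr d)).card : ℝ) ≤ U.card * (Fintype.card D / u) := by
  classical
  have h : (univ.filter fun d => i ∈ U.image (G.tr d))
      ⊆ U.biUnion fun m => univ.filter fun d => G.tr d m = i := by
    intro d
    simp
  calc ((univ.filter fun d => i ∈ U.image (G.tr d)).card : ℝ)
      ≤ ∑ m ∈ U, ((univ.filter fun d => G.tr d m = i).card : ℝ) := by
        exact_mod_cast (card_le_card h).trans card_biUnion_le
    _ ≤ ∑ _m ∈ U, (Fintype.card D / u : ℝ) := sum_le_sum fun m _ => hG m i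
    _ = _ := by rw [sum_const, nsmul_eq_mul]

/-- Each class of permutations with equal advice and equal inner answers is compared with its own
middle game; averaging over the classes replaces the deficit by `S log 2`. -/
lemma mul_successProb_le [Nonempty D] (G : Game N D M V) {u : ℝ} (hu : 0 < u)
    (hG : G.IsUniform u) {S T : ℕ} (A : PreprocAlg N M V S) (hA : A.MakesAtMost T) {l a b : ℝ}
    (ha : 0 ≤ a) (h : LogMGFBound l a b) :
    l * G.successProb A ≤ a * G.midMaxS T + b + 2 * (T / u) * (S * Real.log 2) := by
  classical
  have hD0 : (0 : ℝ) < Fintype.card D := by exact_mod_cast Fintype.card_pos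
  set C : (Fin S → Bool) → Perm (Fin N) → Finset (Perm (Fin N)) := fun z σ =>
    agreeing ((A.online z).known σ) σ with hC
  have hCrefl : ∀ z σ, σ ∈ C z σ := fun z σ => by simp [hC, mem_agreeing]
  have hCeq : ∀ z σ τ, τ ∈ C z σ → C z τ = C z σ := fun z σ τ hτ =>
    OnlineAlg.agreeing_known_eq hτ
  set X : Perm (Fin N) → Finset (Perm (Fin N)) := fun σ =>
    (C (A.pre σ) σ).filter fun τ => A.pre τ = A.pre σ with hX
  have hXrefl : ∀ σ, σ ∈ X σ := fun σ => by simp [hX, hCrefl]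
  have hXeq : ∀ σ τ, τ ∈ X σ → X τ = X σ := fun σ τ hτ => by
    simp only [hX, mem_filter] at hτ ⊢
    rw [hτ.2, hCeq _ _ _ hτ.1]
  set F : Perm (Fin N) → ℝ := fun σ =>
    𝔼 d : D, if G.sucOnline (A.online (A.pre σ)) σ d then (1 : ℝ) else 0 with hF
  have hclass : ∀ σ, l * 𝔼 τ ∈ X σ, F τ ≤ a * G.midMaxS T + b
      + 2 * (T / u) * Real.log ((C (A.pre σ) σ).card / (X σ).card) := by
    intro σ
    set A' := A.online (A.pre σ) with hA'
    set B := A'.midAdversary σ with hB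
    have hFB : 𝔼 τ ∈ X σ, F τ = 𝔼 τ ∈ X σ, 𝔼 d, if G.sucMid B τ d then (1 : ℝ) else 0 := by
      refine expect_congr rfl fun τ hτ => ?_
      simp only [hX, mem_filter] at hτ
      simp only [hF, hτ.2]
      refine expect_congr rfl fun d _ => ?_
      rw [G.sucOnline_eq_sucMid _ hτ.1]
    have hcount : ∀ i, ((univ.filter fun d => i ∈ A'.outer.image (G.tr d)).card : ℝ)
        ≤ T * (Fintype.card D / u) := fun i => by
      refine (G.card_filter_mem_image_tr_le hG _ i).trans ?_
      have : A'.outer.card ≤ T := le_trans (by simp [OnlineAlg.queries, hA']) (hA (A.pre σ))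
      gcongr
    have key := expect_mem_agreeing_le (A'.known σ) σ (fun d => A'.outer.image (G.tr d)) hcount h
      (X := X σ) ⟨σ, hXrefl σ⟩ (filter_subset _ _)
      (fun d τ => if G.sucMid B τ d then (1 : ℝ) else 0)
      (fun d τ => by split_ifs <;> simp)
      (fun d τ τ' hττ' => by
        rw [G.sucMid_congr B d fun m hm => hττ' _ (mem_image_of_mem _ hm)])
    rw [← hFB, ← OnlineAlg.perms_midAdversary] at key
    have hq : 𝔼 τ ∈ B.perms, 𝔼 d, (if G.sucMid B τ d then (1 : ℝ) else 0) ≤ G.midMaxS T :=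
      G.midSuccessProb_le_midMaxS ((A'.time_midAdversary_le σ).trans (hA _))
    have hmul := mul_le_mul_of_nonneg_left hq ha
    have hcoef : 2 * (T * (Fintype.card D / u)) / Fintype.card D = 2 * (T / u) := by
      field_simp
    rw [hcoef, OnlineAlg.perms_midAdversary] at key
    rw [OnlineAlg.perms_midAdversary] at hmul
    linarith
  have hent := expect_log_card_div_card_le A.pre C hCrefl hCeq
  have hcard : Real.log (Fintype.card (Fin S → Bool)) = S * Real.log 2 := by simp
  rw [hcard] at hent
  have hsp : G.successProb A = 𝔼 σ, 𝔼 τ ∈ X σ, F τ :=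
    (expect_expect_class X hXrefl hXeq F).symm
  rw [hsp, mul_expect]
  refine (expect_le_expect fun σ _ => hclass σ).trans ?_
  rw [expect_add_distrib, expect_const univ_nonempty, ← mul_expect]
  have : 0 ≤ 2 * (T / u) := by positivity
  linarith [mul_le_mul_of_nonneg_left hent this]

end Game

end PermChallenge

theorem theorem4p3 {N : ℕ} (hN : 0 < N) {D M V : Type*} [Fintype D] [Nonempty D]
    (G : PermChallenge.Game N D M V) {u : ℝ} (hu : 0 < u) (hG : G.IsUniform u)
    {S T : ℕ} (A : PermChallenge.PreprocAlg N M V S) (hA : A.MakesAtMost T) :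
    G.successProb A ≤
      min (2 * G.midMaxS T + 4 * Real.log 2 * (S : ℝ) * (T : ℝ) / u)
        (G.midMaxS T + Real.sqrt (Real.log 2 * (S : ℝ) * (T : ℝ) / u)) := by
  have hlog := Real.log_nonneg one_le_two
  set K := Real.log 2 * (S : ℝ) * (T : ℝ) / u with hK
  have hK0 : 0 ≤ K := by positivity
  have e : 2 * (T / u) * (S * Real.log 2) = 2 * K := by rw [hK]; ring
  refine le_min ?_ ?_
  -- Here `l = 1`, which gives `2 * K`, stronger than the required `4 * K`.
  · have h := G.mul_successProb_le hu hG A hA zero_le_two PermChallenge.logMGFBound_one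
    rw [e] at h
    have e' : 4 * Real.log 2 * (S : ℝ) * (T : ℝ) / u = 4 * K := by rw [hK]; ring
    rw [e']
    linarith
  · have h : ∀ l : ℝ, 0 < l → G.successProb A - G.midMaxS T ≤ l / 8 + 2 * K / l := by
      intro l hl
      have h := G.mul_successProb_le hu hG A hA hl.le (PermChallenge.logMGFBound_hoeffding l)
      rw [e] at h
      refine le_of_mul_le_mul_left ?_ hl
      have : l * (l / 8 + 2 * K / l) = l ^ 2 / 8 + 2 * K := by field_simp
      rw [this]
      linarith
    -- The minimiser of `l / 8 + 2 * K / l` is `l = 4 * √K`, with value `√K`. For `K = 0` it is not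
    -- positive, and `l → 0` is used instead.
    rcases hK0.eq_or_lt with h0 | h0
    · rw [← h0] at h ⊢
      rw [Real.sqrt_zero, add_zero]
      refine le_of_forall_pos_le_add fun ε hε => ?_
      have := h (8 * ε) (by positivity)
      simp only [mul_zero, zero_div, add_zero] at this
      linarith
    · have hs := Real.sqrt_pos.2 h0
      have h1 := h (4 * Real.sqrt K) (by positivity)
      have h2 : 4 * Real.sqrt K / 8 + 2 * K / (4 * Real.sqrt K) = Real.sqrt K := by
        field_simp
        nlinarith [Real.sq_sqrt hK0]
      linarith
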